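/- For a group $G$, let $(C^\bullet_b(G),\delta^\bullet)$ be the bar complex of bounded functions $G^n\to\mathbb R$, with $\delta^n f(g_1,\dots,g_{n+1})=f(g_2,\dots,g_{n+1})+\sum_{i=1}^n(-1)^if(\dots,g_ig_{i+1},\dots)+(-1)^{n+1}f(g_1,\dots,g_n)$ (a formula also used for unbounded functions), let $H^n_b(G)$ be its cohomology (bounded cohomology with trivial real coefficients), and let $[f]\smile[f']=[f\smile f']$, where $(f\smile f')(g_1,\dots,g_{n+m})=f(g_1,\dots,g_n)\,f'(g_{n+1},\dots,g_{n+m})$. A quasimorphism is a map $\varphi:G\to\mathbb R$ whose defect $D(\varphi)=\sup_{g,h}|\varphi(g)+\varphi(h)-\varphi(gh)|$ is finite; then $\delta^1\varphi$ is a bounded $2$-cocycle. Let $F$ be a free group of finite rank $n\ge 2$ with basis $s_1,\dots,s_n$ and word length $|\cdot|$. A word $w'$ is a subword of $w$ if $w=uw'v$ as a reduced product. Two words overlap if one is a proper subword of the other, or if they can be written, in some order, as reduced products $xy$ and $yz$ with $x,y,z$ non-empty. A word is non-self-overlapping if it does not overlap itself; $\mathcal N$ is the set of these words, and $\mathcal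 N^+\subset\mathcal N$ contains precisely one of $g,g^{-1}$ for every $1\ne g\in\mathcal N$. A set $I\subset F$ is symmetric if $I=I^{-1}$, and independent if no two (equal or distinct) words in $I$ overlap. A map $\alpha$ is alternating if $\alpha(g^{-1})=-\alpha(g)$. For $w\in F$ let $H_w(g)$ be the number of occurrences of $w$ as a subword of $g$ minus that of $w^{-1}$, and let $h_w(g)$ be the maximal number of disjoint occurrences of $w$ in $g$ minus that of $w^{-1}$. For an alternating $\alpha:F\to\mathbb R$ supported on $\mathcal N$ put $\varphi_\alpha=\sum_{w\in\mathcal N^+}\alpha_w h_w$ (a finite sum at each $g$, independent of the choice of $\mathcal N^+$). One writes $\varphi_\alpha\in\ell^1_{Ind}$ if $\alpha=\sum_{i\ge1}\alpha_i$ with each $\alpha_i$ bounded, alternating and supported on a symmetric independent set $I_i$, and $\sum_i\|\alpha_i\|_\infty<\infty$; $SInd_\alpha$ is the infimum of $\sum_i\|\alpha_i\|_\infty$ over all such presentations. For a family $\lambda=(\lambda_1,\dots,\lambda_n)$ of bounded alternating maps $\mathbb Z\to\mathbb R$, the Rolli quasimorphism is $\phi_\lambda(s_{i_1}^{m_1}\cdots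 s_{i_k}^{m_k})=\sum_j\lambda_{i_j}(m_j)$ (consecutive generators distinct, $m_j\neq0$), and $\|\lambda\|_\infty=\max_i\|\lambda_i\|_\infty$. **Statement.** There is a universal constant $C>0$ such that for every $n\ge 2$, every free group $F$ of rank $n$ with a fixed basis, and every word $w\in F$ (self-overlapping or not): 1. if $\varphi_\alpha\in\ell^1_{Ind}$, then $\varphi_\alpha$ and $H_w$ are quasimorphisms, $[\delta^1\varphi_\alpha]\smile[\delta^1H_w]=0\in H^4_b(F)$, and there is a bounded $\pi:F^3\to\mathbb R$ with $\delta^3\pi=\delta^1\varphi_\alpha\smile\delta^1H_w$ and $\|\pi\|_\infty\le C\cdot SInd_\alpha\cdot D(H_w)\,|w|$; 2. if $\phi_\lambda$ is a Rolli quasimorphism as above, then $\phi_\lambda$ and $H_w$ are quasimorphisms, $[\delta^1\phi_\lambda]\smile[\delta^1H_w]=0\in H^4_b(F)$, and there is a bounded $\pi:F^3\to\mathbb R$ with $\delta^3\pi=\delta^1\phi_\lambda\smile\delta^1H_w$ and $\|\pi\|_\infty\le C\cdot\|\lambda\|_\infty\cdot D(H_w)\,|w|$. -/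

import Mathlib

/-! ### Bounded functions -/

/-- A real function is bounded. -/
def IsBddFun {X : Type*} (f : X → ℝ) : Prop := ∃ K : ℝ, ∀ x, |f x| ≤ K

/-- The supremum norm `‖f‖_∞` of a bounded real function. -/
noncomputable def supNorm {X : Type*} (f : X → ℝ) : ℝ := ⨆ x, |f x|

/-! ### The bar resolution and bounded cohomology with trivial real coefficients -/

namespace BddCohomology

/-- Inhomogeneous `n`-cochains `G^n → ℝ`. -/
abbrev Cochain (G : Type*) (n : ℕ) : Type _ := (Fin n → G) → ℝ

/-- The coboundary
`δⁿ f (g₁, …, gₙ₊₁) = f (g₂, …, gₙ₊₁) + ∑_{i=1}^{n} (-1)^i f (…, gᵢ gᵢ₊₁, …) + (-1)^(n+1) f (g₁, …, gₙ)`.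
In the sum below, the index `j < n` stands for `i = j + 1` (the entries `j` and `j + 1`, counted
from `0`, are multiplied), and the index `j = n` drops the last entry. -/
noncomputable def d (G : Type*) [Group G] (n : ℕ) : Cochain G n →ₗ[ℝ] Cochain G (n + 1) where
  toFun f g := f (fun i => g i.succ) +
    ∑ j : Fin (n + 1), (-1 : ℝ) ^ ((j : ℕ) + 1) * f (Fin.contractNth j (· * ·) g)
  map_add' f f' := by
    funext g
    simp only [Pi.add_apply, mul_add, Finset.sum_add_distrib]
    ring
  map_smul' c f := by
    funext g
    simp only [Pi.smul_apply, smul_eq_mul, RingHom.id_apply, mul_add, Finset.mul_sum]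
    congr 1
    exact Finset.sum_congr rfl fun j _ => by ring

/-- Bounded cochains. -/
def Cb (G : Type*) (n : ℕ) : Submodule ℝ (Cochain G n) where
  carrier := {f | IsBddFun f}
  zero_mem' := ⟨0, fun x => by simp⟩
  add_mem' := by
    rintro f f' ⟨K, hK⟩ ⟨K', hK'⟩
    exact ⟨K + K', fun x => (abs_add_le _ _).trans (add_le_add (hK x) (hK' x))⟩
  smul_mem' := by
    rintro c f ⟨K, hK⟩
    refine ⟨|c| * K, fun x => ?_⟩
    simpa [abs_mul] using mul_le_mul_of_nonneg_left (hK x) (abs_nonneg c)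

/-- Bounded cocycles. -/
noncomputable def Zb (G : Type*) [Group G] (n : ℕ) : Submodule ℝ (Cochain G n) :=
  Cb G n ⊓ LinearMap.ker (d G n)

/-- Coboundaries of bounded cochains. -/
noncomputable def Bb (G : Type*) [Group G] : (n : ℕ) → Submodule ℝ (Cochain G n)
  | 0 => ⊥
  | n + 1 => (Cb G n).map (d G n)

/-- The bounded cohomology `Hⁿ_b(G) = Zⁿ_b(G) / Bⁿ_b(G)`. -/
abbrev Hb (G : Type*) [Group G] (n : ℕ) : Type _ := Zb G n ⧸ (Bb G n).submoduleOf (Zb G n)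

/-- The cup product of cochains,
`(f ⌣ f') (g₁, …, gₙ₊ₘ) = f (g₁, …, gₙ) f' (gₙ₊₁, …, gₙ₊ₘ)`. -/
def cup {G : Type*} {n m k : ℕ} (h : n + m = k) (f : Cochain G n) (f' : Cochain G m) :
    Cochain G k :=
  fun g => f (fun i => g (Fin.cast h (Fin.castAdd m i))) *
    f' (fun i => g (Fin.cast h (Fin.natAdd n i)))

/-- The Leibniz rule `δ (f ⌣ f') = δ f ⌣ f' + (-1)ⁿ f ⌣ δ f'`. -/
theorem d_cup {G : Type*} [Group G] {n m k : ℕ} (h : n + m = k)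
    (f : Cochain G n) (f' : Cochain G m) :
    d G k (cup h f f') = cup (by omega) (d G n f) f' +
      (-1 : ℝ) ^ n • cup (by omega) f (d G m f') := by
  subst h
  funext g
  change _ + ∑ j : Fin (n + (m + 1)), _ = (_ + ∑ j : Fin (n + 1), _) * _ +
    (-1 : ℝ) ^ n * (_ * (_ + ∑ j : Fin (m + 1), _))
  rw [Fin.sum_univ_add, Fin.sum_univ_castSucc (n := n)]
  have key : ∀ (p : ℕ) (j : Fin (p + 1)) (x : Fin (p + 1) → G) (i : Fin p),
      Fin.contractNth j (· * ·) x i = if (i : ℕ) < j then x i.castSucc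
        else if (i : ℕ) = j then x i.castSucc * x i.succ else x i.succ := by
    intro p j x i
    simp only [Fin.contractNth]
  have e0 : cup rfl f f' (fun i => g i.succ) =
      f (fun i => g (Fin.cast (by omega) (Fin.castAdd m i.succ))) *
        f' (fun i => g (Fin.cast (by omega) (Fin.natAdd (n + 1) i))) := by
    simp only [cup]
    congr 2 <;> (funext i; congr 1; ext; simp; omega)
  have e1 : ∀ j : Fin n, cup rfl f f'
      (Fin.contractNth (n := n + m) (Fin.castAdd (m + 1) j) (· * ·) g) =
      f (Fin.contractNth j.castSucc (· * ·)
        (fun i => g (Fin.cast (by omega) (Fin.castAdd m i)))) *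
        f' (fun i => g (Fin.cast (by omega) (Fin.natAdd (n + 1) i))) := by
    intro j
    simp only [cup]
    congr 2
    funext i
    rw [key]
    have hj := j.2
    simp only [Fin.val_cast, Fin.val_natAdd, Fin.val_castAdd]
    rw [if_neg (by omega), if_neg (by omega)]
    congr 1
    ext
    simp
    omega
  have e2 : ∀ j : Fin (m + 1), cup rfl f f'
      (Fin.contractNth (n := n + m) (Fin.natAdd n j) (· * ·) g) =
      f (fun i => g (Fin.cast (by omega) (Fin.castAdd (m + 1) i))) *
        f' (Fin.contractNth j (· * ·)
          (fun i => g (Fin.cast (by omega) (Fin.natAdd n i)))) := by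
    intro j
    simp only [cup]
    congr 2
    · funext i
      rw [key]
      have hi := i.2
      simp only [Fin.val_cast, Fin.val_natAdd, Fin.val_castAdd]
      rw [if_pos (by omega)]
      rfl
    · funext i
      rw [key, key]
      simp only [Fin.val_cast, Fin.val_natAdd, Nat.add_lt_add_iff_left, Nat.add_left_cancel_iff]
      rfl
  have e3 : f (Fin.contractNth (Fin.last n) (· * ·)
        (fun i => g (Fin.cast (by omega) (Fin.castAdd m i)))) =
      f (fun i => g (Fin.cast (by omega) (Fin.castAdd (m + 1) i))) := by
    congr 1
    funext i
    rw [key, if_pos (by simp)]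
    rfl
  have e4 : f' (fun i => g (Fin.cast (by omega) (Fin.natAdd n (Fin.succ i)))) =
      f' (fun i => g (Fin.cast (by omega) (Fin.natAdd (n + 1) i))) := by
    congr 1
    funext i
    congr 1
    ext
    simp
    omega
  rw [e0, Finset.sum_congr rfl fun j _ => by rw [e1 j],
    Finset.sum_congr rfl fun (j : Fin (m + 1)) _ => by rw [e2 j], e3, e4]
  simp only [add_mul, mul_add, Finset.sum_mul, Finset.mul_sum, Fin.val_castAdd, Fin.val_natAdd,
    Fin.val_castSucc, Fin.val_last]
  simp only [pow_add, pow_one]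
  ring_nf

theorem cup_mem_Cb {G : Type*} {n m k : ℕ} (h : n + m = k) {f : Cochain G n} {f' : Cochain G m}
    (hf : f ∈ Cb G n) (hf' : f' ∈ Cb G m) : cup h f f' ∈ Cb G k := by
  obtain ⟨K, hK⟩ := hf
  obtain ⟨K', hK'⟩ := hf'
  refine ⟨K * K', fun x => ?_⟩
  simp only [cup, abs_mul]
  exact mul_le_mul (hK _) (hK' _) (abs_nonneg _)
    ((abs_nonneg _).trans (hK fun i => x (Fin.cast h (Fin.castAdd m i))))

theorem cup_zero_left {G : Type*} {n m k : ℕ} (h : n + m = k) (f' : Cochain G m) :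
    cup h (0 : Cochain G n) f' = 0 := by
  funext g; simp [cup]

theorem cup_zero_right {G : Type*} {n m k : ℕ} (h : n + m = k) (f : Cochain G n) :
    cup h f (0 : Cochain G m) = 0 := by
  funext g; simp [cup]

theorem cup_mem_Zb {G : Type*} [Group G] {n m k : ℕ} (h : n + m = k)
    {f : Cochain G n} {f' : Cochain G m} (hf : f ∈ Zb G n) (hf' : f' ∈ Zb G m) :
    cup h f f' ∈ Zb G k := by
  refine ⟨cup_mem_Cb h hf.1 hf'.1, ?_⟩
  have h1 : d G n f = 0 := hf.2
  have h2 : d G m f' = 0 := hf'.2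
  change d G k (cup h f f') = 0
  rw [d_cup, h1, h2, cup_zero_left, cup_zero_right, smul_zero, add_zero]

theorem cup_mem_Bb_left {G : Type*} [Group G] {n m k : ℕ} (h : n + m = k)
    {f : Cochain G n} {f' : Cochain G m} (hf : f ∈ Bb G n) (hf' : f' ∈ Zb G m) :
    cup h f f' ∈ Bb G k := by
  cases n with
  | zero =>
    have h0 : f = 0 := hf
    rw [h0, cup_zero_left]
    exact Submodule.zero_mem _
  | succ n =>
    obtain ⟨b, hb, rfl⟩ := hf
    obtain ⟨k, rfl⟩ : ∃ k', k = k' + 1 := ⟨n + m, by omega⟩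
    have h2 : d G m f' = 0 := hf'.2
    refine ⟨cup (by omega) b f', cup_mem_Cb _ hb hf'.1, ?_⟩
    rw [d_cup, h2, cup_zero_right, smul_zero, add_zero]

theorem cup_mem_Bb_right {G : Type*} [Group G] {n m k : ℕ} (h : n + m = k)
    {f : Cochain G n} {f' : Cochain G m} (hf : f ∈ Zb G n) (hf' : f' ∈ Bb G m) :
    cup h f f' ∈ Bb G k := by
  cases m with
  | zero =>
    have h0 : f' = 0 := hf'
    rw [h0, cup_zero_right]
    exact Submodule.zero_mem _
  | succ m =>
    obtain ⟨b, hb, rfl⟩ := hf'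
    obtain ⟨k, rfl⟩ : ∃ k', k = k' + 1 := ⟨n + m, by omega⟩
    have h2 : d G n f = 0 := hf.2
    refine ⟨(-1 : ℝ) ^ n • cup (by omega) f b,
      Submodule.smul_mem _ _ (cup_mem_Cb _ hf.1 hb), ?_⟩
    rw [map_smul, d_cup, h2, cup_zero_left, zero_add, smul_smul, ← mul_pow]
    simp

/-- The cup product of bounded cocycles. -/
noncomputable def cupZ {G : Type*} [Group G] {n m k : ℕ} (h : n + m = k) :
    Zb G n →ₗ[ℝ] Zb G m →ₗ[ℝ] Zb G k :=
  LinearMap.mk₂ ℝ (fun f f' => ⟨cup h f.1 f'.1, cup_mem_Zb h f.2 f'.2⟩)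
    (fun f₁ f₂ f' => Subtype.ext (funext fun g => by simp [cup, add_mul]))
    (fun c f f' => Subtype.ext (funext fun g => by simp [cup, mul_assoc]))
    (fun f f₁ f₂ => Subtype.ext (funext fun g => by simp [cup, mul_add]))
    (fun c f f' => Subtype.ext (funext fun g => by simp [cup, mul_left_comm]))

/-- The cup product `Hⁿ_b(G) × Hᵐ_b(G) → Hⁿ⁺ᵐ_b(G)`, `[f] ⌣ [f'] = [f ⌣ f']`. -/
noncomputable def cupH {G : Type*} [Group G] {n m k : ℕ} (h : n + m = k) :
    Hb G n →ₗ[ℝ] Hb G m →ₗ[ℝ] Hb G k :=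
  LinearMap.liftQ₂ ((Bb G n).submoduleOf (Zb G n)) ((Bb G m).submoduleOf (Zb G m))
    ((cupZ h).compr₂ ((Bb G k).submoduleOf (Zb G k)).mkQ)
    (by
      intro f hf
      rw [LinearMap.mem_ker]
      ext f'
      exact (Submodule.Quotient.mk_eq_zero _).2 (cup_mem_Bb_left h hf f'.2))
    (by
      intro f' hf'
      rw [LinearMap.mem_ker]
      ext f
      exact (Submodule.Quotient.mk_eq_zero _).2 (cup_mem_Bb_right h f.2 hf'))

end BddCohomology

/-! ### Quasimorphisms -/

/-- `φ` is a quasimorphism: `|φ(g) + φ(h) - φ(gh)|` is uniformly bounded. -/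
def IsQuasimorphism {G : Type*} [Group G] (φ : G → ℝ) : Prop :=
  IsBddFun fun p : G × G => φ p.1 + φ p.2 - φ (p.1 * p.2)

/-- The defect `D(φ) = sup |φ(g) + φ(h) - φ(gh)|` of a quasimorphism. -/
noncomputable def defect {G : Type*} [Group G] (φ : G → ℝ) : ℝ :=
  supNorm fun p : G × G => φ p.1 + φ p.2 - φ (p.1 * p.2)

namespace BddCohomology

/-- The coboundary `δ¹ φ` of a map `φ : G → ℝ`, seen as an inhomogeneous `1`-cochain. -/
noncomputable def δ₁ {G : Type*} [Group G] (φ : G → ℝ) : Cochain G 2 :=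
  d G 1 fun g => φ (g 0)

theorem δ₁_apply {G : Type*} [Group G] (φ : G → ℝ) (g : Fin 2 → G) :
    δ₁ φ g = φ (g 0) + φ (g 1) - φ (g 0 * g 1) := by
  simp [δ₁, d, Fin.sum_univ_succ, Fin.contractNth]
  ring

theorem δ₁_mem_Zb {G : Type*} [Group G] {φ : G → ℝ} (h : IsQuasimorphism φ) :
    δ₁ φ ∈ Zb G 2 := by
  obtain ⟨K, hK⟩ := h
  refine ⟨⟨K, fun g => ?_⟩, ?_⟩
  · rw [δ₁_apply]
    exact hK (g 0, g 1)
  · change d G 2 (δ₁ φ) = 0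
    funext g
    simp [d, δ₁_apply, Fin.sum_univ_succ, Fin.contractNth, mul_assoc]
    ring

/-- The class `[δ¹ φ] ∈ H²_b(G)` of a quasimorphism `φ`. -/
noncomputable def qmClass {G : Type*} [Group G] (φ : G → ℝ) (h : IsQuasimorphism φ) : Hb G 2 :=
  Submodule.Quotient.mk ⟨δ₁ φ, δ₁_mem_Zb h⟩

end BddCohomology

/-! ### Words in a free group

The free group on `S` with its basis `S`; `w.toWord` is the reduced word of `w` (the letter
`(s, true)` is `s`, and `(s, false)` is `s⁻¹`), and `w.norm` is the word length `|w|`.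
Contiguous blocks of a reduced word are reduced, so factorizations of `w` into reduced products
correspond to factorizations of the list `w.toWord`. -/

namespace FreeWord

/-- `v` is a subword of `w`: one has `w = x v y` as a reduced product. -/
def IsSubword {S : Type*} [DecidableEq S] (v w : FreeGroup S) : Prop :=
  v.toWord <:+: w.toWord

/-- `v` and `w` can be written as reduced products `v = x y`, `w = y z`, with `x, y, z`
non-empty. -/
def OverlapRight {S : Type*} [DecidableEq S] (v w : FreeGroup S) : Prop :=
  ∃ x y z : List (S × Bool), x ≠ [] ∧ y ≠ [] ∧ z ≠ [] ∧ v.toWord = x ++ y ∧ w.toWord = y ++ z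

/-- Two words overlap if either one is a proper subword of the other, or if they overlap
properly. -/
def Overlap {S : Type*} [DecidableEq S] (v w : FreeGroup S) : Prop :=
  (v ≠ w ∧ (IsSubword v w ∨ IsSubword w v)) ∨ OverlapRight v w ∨ OverlapRight w v

/-- The set `𝒩` of non-self-overlapping words. -/
def nonSelfOverlapping (S : Type*) [DecidableEq S] : Set (FreeGroup S) :=
  {w | ¬ Overlap w w}

/-- A set of words is independent if no two words in it overlap; in particular no word in it is
self-overlapping. -/
def IsIndependent {S : Type*} [DecidableEq S] (I : Set (FreeGroup S)) : Prop :=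
  ∀ v ∈ I, ∀ w ∈ I, ¬ Overlap v w

/-- `I = I⁻¹`. -/
def IsSymmetric {S : Type*} (I : Set (FreeGroup S)) : Prop := ∀ w ∈ I, w⁻¹ ∈ I

/-- `P` is a choice of `W⁺`: a subset of the symmetric set `W` that contains precisely one of
`g, g⁻¹` for every `1 ≠ g ∈ W`. -/
def IsPositiveHalf {S : Type*} (W P : Set (FreeGroup S)) : Prop :=
  P ⊆ W ∧ ∀ g ∈ W, g ≠ 1 → Xor (g ∈ P) (g⁻¹ ∈ P)

/-- `f(g⁻¹) = -f(g)`. -/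
def IsAlternating {G : Type*} [Group G] (f : G → ℝ) : Prop := ∀ g, f g⁻¹ = -f g

/-! ### Brooks quasimorphisms -/

/-- The positions at which `w` occurs as a subword of `g`. -/
def occurrences {S : Type*} [DecidableEq S] (w g : FreeGroup S) : Finset ℕ :=
  (Finset.range (g.norm + 1)).filter fun i => w.toWord <+: g.toWord.drop i

/-- The big counting function `C_w`: the number of occurrences of `w` as a subword of `g`. -/
def bigCount {S : Type*} [DecidableEq S] (w g : FreeGroup S) : ℕ := (occurrences w g).card

/-- The big Brooks quasimorphism `H_w = C_w - C_{w⁻¹}`. -/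
def bigBrooks {S : Type*} [DecidableEq S] (w g : FreeGroup S) : ℝ :=
  (bigCount w g : ℝ) - (bigCount w⁻¹ g : ℝ)

/-- The small counting function `c_w`: the maximal number of disjoint occurrences of `w` as a
subword of `g`. -/
def smallCount {S : Type*} [DecidableEq S] (w g : FreeGroup S) : ℕ :=
  ((occurrences w g).powerset.filter fun t =>
    ∀ i ∈ t, ∀ j ∈ t, i < j → i + w.norm ≤ j).sup Finset.card

/-- The small Brooks quasimorphism `h_w = c_w - c_{w⁻¹}`. -/
def smallBrooks {S : Type*} [DecidableEq S] (w g : FreeGroup S) : ℝ :=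
  (smallCount w g : ℝ) - (smallCount w⁻¹ g : ℝ)

theorem smallCount_eq_zero {S : Type*} [DecidableEq S] {w g : FreeGroup S}
    (h : ¬ IsSubword w g) : smallCount w g = 0 := by
  have h0 : occurrences w g = ∅ := by
    refine Finset.filter_eq_empty_iff.2 fun i _ hi => h ?_
    exact hi.isInfix.trans (List.drop_suffix i _).isInfix
  simp [smallCount, h0, Finset.filter_singleton]

/-- For each `g` only finitely many words `w` satisfy `h_w(g) ≠ 0`. -/
theorem finite_support_smallBrooks {S : Type*} [DecidableEq S] (g : FreeGroup S) :
    {w : FreeGroup S | smallBrooks w g ≠ 0}.Finite := by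
  have hfin : {w : FreeGroup S | IsSubword w g}.Finite := by
    refine ((g.toWord.sublists.toFinset.finite_toSet).preimage
      FreeGroup.toWord_injective.injOn).subset fun w hw => ?_
    simpa using List.IsInfix.sublist hw
  refine (hfin.union (hfin.preimage (inv_injective.injOn))).subset fun w hw => ?_
  by_contra hc
  simp only [Set.mem_union, Set.mem_ofPred_eq, Set.mem_preimage, not_or] at hc
  exact hw (by simp [smallBrooks, smallCount_eq_zero hc.1, smallCount_eq_zero hc.2])

/-- `φ_α = ∑_{w ∈ P} α_w h_w`, where `P` is a choice of `𝒩⁺`; at every `g` the sum is finite. -/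
noncomputable def brooksSum {S : Type*} [DecidableEq S] (P : Set (FreeGroup S))
    (α : FreeGroup S → ℝ) (g : FreeGroup S) : ℝ :=
  ∑ᶠ w ∈ P, α w * smallBrooks w g

/-! ### The space `ℓ¹_Ind` -/

/-- `α = ∑ᵢ βᵢ` with `∑ᵢ ‖βᵢ‖_∞ < ∞`, where each `βᵢ` is bounded, alternating, and supported on a
symmetric independent family. -/
structure IsIndSum {S : Type*} [DecidableEq S] (α : FreeGroup S → ℝ)
    (β : ℕ → FreeGroup S → ℝ) : Prop where
  bdd : ∀ i, IsBddFun (β i)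
  alternating : ∀ i, IsAlternating (β i)
  supported : ∀ i, ∃ I : Set (FreeGroup S), IsSymmetric I ∧ IsIndependent I ∧
    Function.support (β i) ⊆ I
  summable : Summable fun i => supNorm (β i)
  hasSum : ∀ w, HasSum (fun i => β i w) (α w)

/-- The coefficient maps `α` (alternating, supported on `𝒩`) with `φ_α ∈ ℓ¹_Ind`. -/
structure MemEllOneInd {S : Type*} [DecidableEq S] (α : FreeGroup S → ℝ) : Prop where
  alternating : IsAlternating α
  supported : Function.support α ⊆ nonSelfOverlapping S
  exists_indSum : ∃ β : ℕ → FreeGroup S → ℝ, IsIndSum α β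

/-- `SInd_α`, the infimum of `∑ᵢ ‖βᵢ‖_∞` over all presentations of `α`. -/
noncomputable def SInd {S : Type*} [DecidableEq S] (α : FreeGroup S → ℝ) : ℝ :=
  sInf {s | ∃ β : ℕ → FreeGroup S → ℝ, IsIndSum α β ∧ s = ∑' i, supNorm (β i)}

/-! ### Rolli quasimorphisms -/

/-- Groups the letters of a reduced word into powers of generators: for
`g = s_{i₁}^{m₁} ⋯ s_{iₖ}^{mₖ}` with consecutive generators distinct and exponents non-zero, the
result is `[(i₁, m₁), …, (iₖ, mₖ)]`. -/
def syllables {S : Type*} [DecidableEq S] : List (S × Bool) → List (S × ℤ)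
  | [] => []
  | (s, b) :: l =>
    match syllables l with
    | [] => [(s, if b then 1 else -1)]
    | (t, m) :: r =>
      if s = t then (t, (if b then 1 else -1) + m) :: r
      else (s, if b then 1 else -1) :: (t, m) :: r

/-- The Rolli quasimorphism `φ_λ`, sending `s_{i₁}^{m₁} ⋯ s_{iₖ}^{mₖ}` to `∑ⱼ λ_{iⱼ}(mⱼ)`. -/
def rolli {S : Type*} [DecidableEq S] (lam : S → ℤ → ℝ) (g : FreeGroup S) : ℝ :=
  ((syllables g.toWord).map fun p => lam p.1 p.2).sum

/-- The parameters of Rolli quasimorphisms: families of bounded alternating maps `ℤ → ℝ`. -/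
def IsRolliParam {S : Type*} (lam : S → ℤ → ℝ) : Prop :=
  ∀ s, IsBddFun (lam s) ∧ ∀ m, lam s (-m) = -lam s m

/-- `‖λ‖_∞ = max_s ‖λ_s‖_∞`. -/
noncomputable def rolliNorm {S : Type*} (lam : S → ℤ → ℝ) : ℝ :=
  supNorm fun p : S × ℤ => lam p.1 p.2

/-! ### Vanishing cup products with a bounded primitive -/

/-- `φ` and `ψ` are quasimorphisms with `[δ¹ φ] ⌣ [δ¹ ψ] = 0` in `H⁴_b(G)`, and `δ¹ φ ⌣ δ¹ ψ` has
a bounded primitive of norm at most `R`. -/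
def CupVanishes {G : Type*} [Group G] (φ ψ : G → ℝ) (R : ℝ) : Prop :=
  ∃ (hφ : IsQuasimorphism φ) (hψ : IsQuasimorphism ψ),
    BddCohomology.cupH (k := 4) rfl (BddCohomology.qmClass φ hφ) (BddCohomology.qmClass ψ hψ) = 0 ∧
    ∃ π : BddCohomology.Cochain G 3, π ∈ BddCohomology.Cb G 3 ∧
      BddCohomology.d G 3 π = BddCohomology.cup rfl (BddCohomology.δ₁ φ) (BddCohomology.δ₁ ψ) ∧
      supNorm π ≤ R

end FreeWord

open FreeGroup

namespace FreeWord

/-! ### Lifts of quasimorphisms to quasi-cocycles of functionals -/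

/-! The cup product vanishes because `φ` lifts to functionals. Suppose that `E g 1 = φ g` and that
`E (gh) f = E g (f(· h)) + E h f` holds up to `K ‖f‖_∞`, while the single `E g` may have unbounded
norm. Put `η(a,b) = E a (δ¹ψ(·,b))`. By the cocycle identity for `δ¹ψ`, the cochain `π = δ²η + φ ⌣
δ¹ψ` is, up to sign, the error of `E` at `(a,b)` on the bounded function `x ↦ δ¹ψ(x,c)`. The first
form gives `δ³π = δ¹φ ⌣ δ¹ψ`, the second `‖π‖_∞ ≤ K D(ψ)` (`IsQuasiLift.cupVanishes`). Any
quasimorphism `ψ` will do.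

In a free group it suffices to control `E` on reduced products when `φ` is alternating:
antisymmetrize `E` and cut the triangle of `g, h, gh` into its three legs, at the cost of a factor 3
(`IsReducedLift.isQuasiLift`).

For `φ_α`, let `E g f` sum `α(v) f(z)` over `g = u v z`. On a reduced product the error comes from
the subwords across the junction, and an independent set has at most one of them there
(`crossing_unique`), so the error is at most `SInd α`. The mass is `φ_α`, since `h_w = H_w` for
non-self-overlapping `w`. For Rolli quasimorphisms, `v` runs over the maximal powers; at most two of
them merge at a junction, which costs three terms. The factors 3 and 3 · 3 give `C = 9`. -/

/-- `E` is a quasi-cocycle with values in functionals on `G → ℝ` (with translation of functions on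
the right), of defect at most `K` with respect to the sup norm, whose mass is `φ`. -/
structure IsQuasiLift {G : Type*} [Group G] (φ : G → ℝ) (E : G → (G → ℝ) →ₗ[ℝ] ℝ) (K : ℝ) :
    Prop where
  mass : ∀ g, E g (fun _ => 1) = φ g
  bound : ∀ g h f M, (∀ x, |f x| ≤ M) →
    |E (g * h) f - E g (fun x => f (x * h)) - E h f| ≤ K * M

theorem IsQuasiLift.isQuasimorphism {G : Type*} [Group G] {φ : G → ℝ}
    {E : G → (G → ℝ) →ₗ[ℝ] ℝ} {K : ℝ} (hE : IsQuasiLift φ E K) : IsQuasimorphism φ := by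
  refine ⟨K * 1, fun p => ?_⟩
  have h := hE.bound p.1 p.2 (fun _ => 1) 1 (fun x => by simp)
  rw [hE.mass, hE.mass, hE.mass] at h
  rw [← abs_neg]
  convert h using 2
  ring

theorem IsQuasimorphism.abs_le_defect {G : Type*} [Group G] {ψ : G → ℝ} (h : IsQuasimorphism ψ)
    (a b : G) : |ψ a + ψ b - ψ (a * b)| ≤ defect ψ := by
  obtain ⟨K, hK⟩ := h
  exact le_ciSup (f := fun p : G × G => |ψ p.1 + ψ p.2 - ψ (p.1 * p.2)|)
    ⟨K, by rintro _ ⟨p, rfl⟩; exact hK p⟩ (a, b)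

theorem defect_nonneg {G : Type*} [Group G] (ψ : G → ℝ) : 0 ≤ defect ψ :=
  Real.iSup_nonneg fun _ => abs_nonneg _

/-- The primitive of `δ¹ φ ⌣ δ¹ ψ` obtained from a lift `E` of `φ`. -/
def liftPrimitive {G : Type*} [Group G] (E : G → (G → ℝ) →ₗ[ℝ] ℝ) (ψ : G → ℝ) :
    BddCohomology.Cochain G 3 := fun g =>
  -(E (g 0 * g 1) (fun x => ψ x + ψ (g 2) - ψ (x * g 2)) -
    E (g 0) (fun x => ψ (x * g 1) + ψ (g 2) - ψ (x * g 1 * g 2)) -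
    E (g 1) (fun x => ψ x + ψ (g 2) - ψ (x * g 2)))

/-- The identity is exact: the terms in `E` form a coboundary `δ²η`, which `δ³` kills, and what
remains is `δ³(φ ⌣ δ¹ψ)`. -/
theorem d_liftPrimitive {G : Type*} [Group G] {φ : G → ℝ} {E : G → (G → ℝ) →ₗ[ℝ] ℝ} {K : ℝ}
    (hE : IsQuasiLift φ E K) (ψ : G → ℝ) :
    BddCohomology.d G 3 (liftPrimitive E ψ) =
      BddCohomology.cup rfl (BddCohomology.δ₁ φ) (BddCohomology.δ₁ ψ) := by
  -- The constant summand `ψ c` is where the mass `φ a` enters.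
  have expand : ∀ a b c, E a (fun x => ψ (x * b) + ψ c - ψ (x * b * c)) =
      E a (fun x => ψ (x * b)) + ψ c * φ a - E a (fun x => ψ (x * (b * c))) := by
    intro a b c
    have : (fun x => ψ (x * b) + ψ c - ψ (x * b * c)) =
        (fun x => ψ (x * b)) + ψ c • (fun _ => (1 : ℝ)) - (fun x => ψ (x * (b * c))) := by
      funext x
      simp [mul_assoc]
    rw [this, map_sub, map_add, map_smul, hE.mass, smul_eq_mul]
  have expand_one : ∀ a c, E a (fun x => ψ x + ψ c - ψ (x * c)) =
      E a (fun x => ψ x) + ψ c * φ a - E a (fun x => ψ (x * c)) := by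
    intro a c
    simpa using expand a 1 c
  have eval : ∀ g, liftPrimitive E ψ g =
      -((E (g 0 * g 1) (fun x => ψ x) + ψ (g 2) * φ (g 0 * g 1) -
          E (g 0 * g 1) (fun x => ψ (x * g 2))) -
        (E (g 0) (fun x => ψ (x * g 1)) + ψ (g 2) * φ (g 0) -
          E (g 0) (fun x => ψ (x * (g 1 * g 2)))) -
        (E (g 1) (fun x => ψ x) + ψ (g 2) * φ (g 1) - E (g 1) (fun x => ψ (x * g 2)))) := by
    intro g
    rw [liftPrimitive, expand, expand_one, expand_one]
  funext g
  have key : BddCohomology.d G 3 (liftPrimitive E ψ) g =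
      liftPrimitive E ψ ![g 1, g 2, g 3] - liftPrimitive E ψ ![g 0 * g 1, g 2, g 3]
      + liftPrimitive E ψ ![g 0, g 1 * g 2, g 3] - liftPrimitive E ψ ![g 0, g 1, g 2 * g 3]
      + liftPrimitive E ψ ![g 0, g 1, g 2] := by
    simp [BddCohomology.d, eval, Fin.sum_univ_succ, Fin.contractNth, mul_assoc]
    ring
  have cup_apply : BddCohomology.cup (k := 4) rfl (BddCohomology.δ₁ φ) (BddCohomology.δ₁ ψ) g =
      (φ (g 0) + φ (g 1) - φ (g 0 * g 1)) * (ψ (g 2) + ψ (g 3) - ψ (g 2 * g 3)) := by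
    simp only [BddCohomology.cup, BddCohomology.δ₁_apply]
    rfl
  rw [key, cup_apply]
  simp only [eval, Matrix.cons_val, mul_assoc]
  ring

theorem IsQuasiLift.cupVanishes {G : Type*} [Group G] {φ ψ : G → ℝ}
    {E : G → (G → ℝ) →ₗ[ℝ] ℝ} {K R : ℝ} (hE : IsQuasiLift φ E K) (hψ : IsQuasimorphism ψ)
    (hR : K * defect ψ ≤ R) : CupVanishes φ ψ R := by
  have hbound : ∀ g, |liftPrimitive E ψ g| ≤ K * defect ψ := by
    intro g
    rw [liftPrimitive, abs_neg]
    exact hE.bound _ _ (fun x => ψ x + ψ (g 2) - ψ (x * g 2)) _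
      fun x => IsQuasimorphism.abs_le_defect hψ x (g 2)
  refine ⟨hE.isQuasimorphism, hψ, ?_, liftPrimitive E ψ, ⟨_, hbound⟩, d_liftPrimitive hE ψ, ?_⟩
  · exact (Submodule.Quotient.mk_eq_zero _).2
      ⟨liftPrimitive E ψ, ⟨_, hbound⟩, d_liftPrimitive hE ψ⟩
  · exact (ciSup_le hbound).trans hR

/-! ### Lifts that are only controlled on reduced products -/

/-- The product `a c` is reduced. -/
def IsReducedMul {S : Type*} [DecidableEq S] (a c : FreeGroup S) : Prop :=
  (a * c).toWord = a.toWord ++ c.toWord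

theorem IsReducedMul.inv {S : Type*} [DecidableEq S] {a c : FreeGroup S} (h : IsReducedMul a c) :
    IsReducedMul c⁻¹ a⁻¹ := by
  unfold IsReducedMul at *
  rw [← mul_inv_rev, toWord_inv, h, invRev_append, toWord_inv, toWord_inv]

theorem toWord_mk_of_isReduced {S : Type*} [DecidableEq S] {l : List (S × Bool)}
    (h : IsReduced l) : (mk l).toWord = l := by
  rw [toWord_mk, h.reduce_eq]

theorem IsReduced.invRev {S : Type*} [DecidableEq S] {l : List (S × Bool)}
    (h : IsReduced l) : IsReduced (FreeGroup.invRev l) := by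
  rw [isReduced_iff_reduce_eq] at *
  rw [reduce_invRev, h]

theorem isReducedMul_mk {S : Type*} [DecidableEq S] {l l' : List (S × Bool)}
    (h : IsReduced (l ++ l')) : IsReducedMul (mk l) (mk l') := by
  have h' := List.isChain_append.1 h
  rw [IsReducedMul, mul_mk, toWord_mk_of_isReduced h, toWord_mk_of_isReduced h'.1,
    toWord_mk_of_isReduced h'.2.1]

/-- Splitting off the longest common prefix of two lists. -/
theorem exists_common_prefix {A : Type*} (l l' : List A) :
    ∃ p r r', l = p ++ r ∧ l' = p ++ r' ∧ ∀ x ∈ r.head?, ∀ y ∈ r'.head?, x ≠ y := by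
  induction l generalizing l' with
  | nil => exact ⟨[], [], l', rfl, rfl, by simp⟩
  | cons a l ih =>
    cases l' with
    | nil => exact ⟨[], a :: l, [], rfl, rfl, by simp⟩
    | cons b l' =>
      by_cases hab : a = b
      · subst hab
        obtain ⟨p, r, r', rfl, rfl, h⟩ := ih l'
        exact ⟨a :: p, r, r', rfl, rfl, h⟩
      · exact ⟨[], a :: l, b :: l', rfl, rfl, by simpa using hab⟩

/-- The three sides of a geodesic triangle in a free group. -/
theorem exists_tripod {S : Type*} [DecidableEq S] (g h : FreeGroup S) :
    ∃ a b c, g = a * c ∧ h = c⁻¹ * b ∧ IsReducedMul a c ∧ IsReducedMul c⁻¹ b ∧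
      IsReducedMul a b := by
  obtain ⟨p, r, r', hg, hh, hne⟩ := exists_common_prefix g⁻¹.toWord h.toWord
  have hgr : IsReduced (p ++ r) := hg ▸ isReduced_toWord
  have hhr : IsReduced (p ++ r') := hh ▸ isReduced_toWord
  have hg' : g = (mk (p ++ r))⁻¹ := by rw [← hg, mk_toWord, inv_inv]
  -- The common prefix `p` of `g⁻¹` and `h` is what cancels in `g h`.
  refine ⟨(mk r)⁻¹, mk r', (mk p)⁻¹, ?_, ?_, ?_, ?_, ?_⟩
  · rw [hg', ← mul_inv_rev, mul_mk]
  · rw [inv_inv, mul_mk, ← hh, mk_toWord]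
  · exact (isReducedMul_mk hgr).inv
  · rw [inv_inv]
    exact isReducedMul_mk hhr
  · rw [inv_mk]
    refine isReducedMul_mk (List.isChain_append.2
      ⟨IsReduced.invRev (List.isChain_append.1 hgr).2.1, (List.isChain_append.1 hhr).2.1, ?_⟩)
    -- The inverse of `x`, the last letter of `r⁻¹`, heads `r`. If `x` and `y` cancelled, `r` and
    -- `r'` would start alike.
    intro x hx y hy hxy
    have hx' : (x.1, !x.2) ∈ r.head? := by
      rw [FreeGroup.invRev, List.getLast?_reverse, List.head?_map] at hx
      obtain ⟨z, hz, rfl⟩ := Option.mem_map.1 hx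
      simpa using hz
    have := hne _ hx' _ hy
    by_contra hc
    exact this (Prod.ext hxy (Bool.not_eq.2 hc))

/-- `E` is additive up to `K` on reduced products, and has mass `φ`. -/
structure IsReducedLift {S : Type*} [DecidableEq S] (φ : FreeGroup S → ℝ)
    (E : FreeGroup S → (FreeGroup S → ℝ) →ₗ[ℝ] ℝ) (K : ℝ) : Prop where
  mass : ∀ g, E g (fun _ => 1) = φ g
  bound : ∀ a c f M, IsReducedMul a c → (∀ x, |f x| ≤ M) →
    |E (a * c) f - E a (fun x => f (x * c)) - E c f| ≤ K * M

/-- The antisymmetrization of a family of functionals. -/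
noncomputable def antisymmetrize {G : Type*} [Group G] (E : G → (G → ℝ) →ₗ[ℝ] ℝ) (g : G) :
    (G → ℝ) →ₗ[ℝ] ℝ :=
  (1 / 2 : ℝ) • (E g - E g⁻¹ ∘ₗ LinearMap.funLeft ℝ ℝ (· * g))

theorem antisymmetrize_apply {G : Type*} [Group G] (E : G → (G → ℝ) →ₗ[ℝ] ℝ) (g : G)
    (f : G → ℝ) : antisymmetrize E g f = (1 / 2) * (E g f - E g⁻¹ (fun x => f (x * g))) := rfl

/-- The cocycle rule for the pair `g, g⁻¹`, now without error. -/
theorem antisymmetrize_inv {G : Type*} [Group G] (E : G → (G → ℝ) →ₗ[ℝ] ℝ) (g : G)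
    (f : G → ℝ) : antisymmetrize E g⁻¹ f = -antisymmetrize E g (fun x => f (x * g⁻¹)) := by
  simp only [antisymmetrize_apply, inv_inv, mul_inv_cancel_right]
  ring

/-- With `a c` also `c⁻¹ a⁻¹` is reduced, and averaging the two errors keeps `K`. -/
theorem IsReducedLift.antisymmetrize {S : Type*} [DecidableEq S] {φ : FreeGroup S → ℝ}
    {E : FreeGroup S → (FreeGroup S → ℝ) →ₗ[ℝ] ℝ} {K : ℝ} (hE : IsReducedLift φ E K)
    (hφ : IsAlternating φ) : IsReducedLift φ (antisymmetrize E) K where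
  mass g := by
    rw [antisymmetrize_apply, hE.mass, hE.mass, hφ]
    ring
  bound a c f M hac hf := by
    have h1 := abs_le.1 (hE.bound a c f M hac hf)
    have h2 := abs_le.1 (hE.bound c⁻¹ a⁻¹ (fun x => f (x * (a * c))) M hac.inv fun x => hf _)
    rw [← mul_inv_rev] at h2
    simp only [antisymmetrize_apply]
    have e : ∀ x : FreeGroup S, x * a⁻¹ * (a * c) = x * c := fun x => by group
    simp only [e] at h2
    simp only [mul_assoc] at h1 h2 ⊢
    rw [abs_le]
    constructor <;> linarith [h1.1, h1.2, h2.1, h2.2]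

/-- The estimates for the reduced products `a c`, `c⁻¹ b` and `a b` add up to `3 * K`; the
contributions of `c` and `c⁻¹` cancel exactly by `antisymmetrize_inv`. -/
theorem IsReducedLift.isQuasiLift {S : Type*} [DecidableEq S] {φ : FreeGroup S → ℝ}
    {E : FreeGroup S → (FreeGroup S → ℝ) →ₗ[ℝ] ℝ} {K : ℝ} (hE : IsReducedLift φ E K)
    (hφ : IsAlternating φ) : IsQuasiLift φ (FreeWord.antisymmetrize E) (3 * K) where
  mass := (hE.antisymmetrize hφ).mass
  bound g h f M hf := by
    obtain ⟨a, b, c, rfl, rfl, hac, hcb, hab⟩ := exists_tripod g h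
    have hE' := hE.antisymmetrize hφ
    have h1 := abs_le.1 (hE'.bound a c (fun x => f (x * (c⁻¹ * b))) M hac fun x => hf _)
    have h2 := abs_le.1 (hE'.bound c⁻¹ b f M hcb hf)
    have h3 := abs_le.1 (hE'.bound a b f M hab hf)
    have e1 : a * c * (c⁻¹ * b) = a * b := by group
    have e2 : ∀ x : FreeGroup S, x * c * (c⁻¹ * b) = x * b := fun x => by group
    rw [antisymmetrize_inv] at h2
    simp only [e2, mul_assoc] at h1 h2 h3
    rw [e1, abs_le]
    simp only [mul_assoc]
    constructor <;> linarith [h1.1, h1.2, h2.1, h2.2, h3.1, h3.2]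

/-! ### Sums over the subwords of a word -/

/-- The functional `f ↦ ∑ α(v) f(z)` over the factorizations `l = v z` with `v` non-empty. -/
noncomputable def prefixFunctional {S : Type*} (α : FreeGroup S → ℝ) (l : List (S × Bool)) :
    (FreeGroup S → ℝ) →ₗ[ℝ] ℝ :=
  ∑ j ∈ Finset.range l.length, α (mk (l.take (j + 1))) • LinearMap.proj (mk (l.drop (j + 1)))

/-- The functional `f ↦ ∑ α(v) f(z)` over the factorizations `l = u v z` with `v` non-empty. -/
noncomputable def subwordFunctional {S : Type*} (α : FreeGroup S → ℝ) (l : List (S × Bool)) :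
    (FreeGroup S → ℝ) →ₗ[ℝ] ℝ :=
  ∑ i ∈ Finset.range l.length, prefixFunctional α (l.drop i)

/-- The subwords of `l l'` that meet both factors, in the form `f ↦ ∑ α(v) f(z)`. -/
noncomputable def crossingSum {S : Type*} (α : FreeGroup S → ℝ) (l l' : List (S × Bool))
    (f : FreeGroup S → ℝ) : ℝ :=
  ∑ p ∈ Finset.range l.length ×ˢ Finset.range l'.length,
    α (mk (l.drop p.1 ++ l'.take (p.2 + 1))) * f (mk (l'.drop (p.2 + 1)))

theorem prefixFunctional_apply {S : Type*} (α : FreeGroup S → ℝ) (l : List (S × Bool))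
    (f : FreeGroup S → ℝ) : prefixFunctional α l f =
      ∑ j ∈ Finset.range l.length, α (mk (l.take (j + 1))) * f (mk (l.drop (j + 1))) := by
  simp [prefixFunctional, LinearMap.sum_apply]

theorem subwordFunctional_apply {S : Type*} (α : FreeGroup S → ℝ) (l : List (S × Bool))
    (f : FreeGroup S → ℝ) : subwordFunctional α l f =
      ∑ i ∈ Finset.range l.length, prefixFunctional α (l.drop i) f := by
  simp [subwordFunctional, LinearMap.sum_apply]

theorem prefixFunctional_append {S : Type*} (α : FreeGroup S → ℝ) (l l' : List (S × Bool))
    (f : FreeGroup S → ℝ) : prefixFunctional α (l ++ l') f =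
      prefixFunctional α l (fun x => f (x * mk l')) +
        ∑ j ∈ Finset.range l'.length,
          α (mk (l ++ l'.take (j + 1))) * f (mk (l'.drop (j + 1))) := by
  simp only [prefixFunctional_apply, List.length_append, Finset.sum_range_add, mul_mk]
  congr 1
  · refine Finset.sum_congr rfl fun j hj => ?_
    have hj := Finset.mem_range.1 hj
    rw [List.take_append_of_le_length (by omega), List.drop_append_of_le_length (by omega)]
  · refine Finset.sum_congr rfl fun j _ => ?_
    rw [add_assoc, List.take_length_add_append, List.drop_length_add_append]

/-- A subword lies in `l`, lies in `l'`, or meets both. In the first case `l'` is appended to the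
remainder `z`, which is the translation of `f`. -/
theorem subwordFunctional_append {S : Type*} (α : FreeGroup S → ℝ) (l l' : List (S × Bool))
    (f : FreeGroup S → ℝ) : subwordFunctional α (l ++ l') f =
      subwordFunctional α l (fun x => f (x * mk l')) + subwordFunctional α l' f +
        crossingSum α l l' f := by
  have h : ∀ i ∈ Finset.range l.length, prefixFunctional α ((l ++ l').drop i) f =
      prefixFunctional α (l.drop i) (fun x => f (x * mk l')) +
        ∑ j ∈ Finset.range l'.length,
          α (mk (l.drop i ++ l'.take (j + 1))) * f (mk (l'.drop (j + 1))) := by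
    intro i hi
    have hi := Finset.mem_range.1 hi
    rw [List.drop_append_of_le_length (by omega), prefixFunctional_append]
  simp only [subwordFunctional_apply, List.length_append, Finset.sum_range_add]
  rw [Finset.sum_congr rfl h, Finset.sum_add_distrib, crossingSum, Finset.sum_product]
  simp only [List.drop_length_add_append]
  ring

theorem isReducedLift_subwordFunctional {S : Type*} [DecidableEq S] {α : FreeGroup S → ℝ} {K : ℝ}
    (hK : ∀ (l l' : List (S × Bool)) f M, IsReduced (l ++ l') → (∀ x, |f x| ≤ M) →
      |crossingSum α l l' f| ≤ K * M) :
    IsReducedLift (fun g => subwordFunctional α g.toWord fun _ => 1)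
      (fun g => subwordFunctional α g.toWord) K where
  mass _ := rfl
  bound a c f M hac hf := by
    have hr : IsReduced (a.toWord ++ c.toWord) := by
      rw [← hac]
      exact isReduced_toWord
    have h := subwordFunctional_append α a.toWord c.toWord f
    rw [← hac, mk_toWord] at h
    rw [h]
    convert hK _ _ f M hr hf using 2
    ring

/-! ### Bounds on the crossing sums -/

theorem isReduced_of_infix {S : Type*} {l l' : List (S × Bool)} (h : IsReduced l')
    (hl : l <:+: l') : IsReduced l := List.IsChain.infix h hl

theorem crossing_infix {A : Type*} (l l' : List A) (i j : ℕ) :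
    l.drop i ++ l'.take j <:+: l ++ l' :=
  ⟨l.take i, l'.drop j, by
    rw [← List.append_assoc, List.take_append_drop, List.append_assoc, List.take_append_drop]⟩

/-- Subwords across the junction share the letters next to it, so at different positions they are
nested or overlap properly. -/
theorem crossing_unique {S : Type*} [DecidableEq S] {I : Set (FreeGroup S)}
    (hI : IsIndependent I) {l l' : List (S × Bool)} (hl : IsReduced (l ++ l')) {i i' j j' : ℕ}
    (hi' : i' < l.length) (hj : j < l'.length) (hj' : j' < l'.length)
    (h : mk (l.drop i ++ l'.take (j + 1)) ∈ I) (h' : mk (l.drop i' ++ l'.take (j' + 1)) ∈ I)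
    (hii : i ≤ i') : i = i' ∧ j = j' := by
  have w : ∀ i j, (mk (l.drop i ++ l'.take (j + 1))).toWord = l.drop i ++ l'.take (j + 1) :=
    fun i j => toWord_mk_of_isReduced (isReduced_of_infix hl (crossing_infix l l' i (j + 1)))
  have hno := hI _ h _ h'
  have hlen : ∀ i j, j < l'.length → (l.drop i ++ l'.take (j + 1)).length = l.length - i + (j + 1) := by
    intro i j hj
    rw [List.length_append, List.length_drop, List.length_take]
    omega
  have hdrop : l.drop i = (l.drop i).take (i' - i) ++ l.drop i' := by
    conv_lhs => rw [← List.take_append_drop (i' - i) (l.drop i)]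
    rw [List.drop_drop, Nat.add_sub_cancel' hii]
  have htake : ∀ j j', j ≤ j' → l'.take (j' + 1) =
      l'.take (j + 1) ++ (l'.take (j' + 1)).drop (j + 1) := by
    intro j j' hjj
    conv_lhs => rw [← List.take_append_drop (j + 1) (l'.take (j' + 1))]
    rw [List.take_take, min_eq_left (by omega)]
  by_contra hne
  -- Nesting counts as overlap only for distinct words. Equal words have equal length, so at
  -- different positions they are shifted.
  have hnew : (mk (l.drop i ++ l'.take (j + 1))) ≠ mk (l.drop i' ++ l'.take (j' + 1)) ∨
      (i < i' ∧ j < j') := by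
    by_contra hc
    push Not at hc
    have := congrArg (fun x => x.toWord.length) hc.1
    simp only [w, hlen _ _ hj, hlen _ _ hj'] at this
    omega
  by_cases hjj : i < i' ∧ j < j'
  · refine hno (Or.inr (Or.inl ⟨(l.drop i).take (i' - i), l.drop i' ++ l'.take (j + 1),
      (l'.take (j' + 1)).drop (j + 1), ?_, ?_, ?_, ?_, ?_⟩))
    · refine List.ne_nil_of_length_pos ?_
      simp
      omega
    · refine List.ne_nil_of_length_pos ?_
      simp
      omega
    · refine List.ne_nil_of_length_pos ?_
      simp
      omega
    · rw [w, ← List.append_assoc, ← hdrop]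
    · rw [w, List.append_assoc, ← htake _ _ hjj.2.le]
  · have hne' := hnew.resolve_right hjj
    refine hno (Or.inl ⟨hne', ?_⟩)
    simp only [IsSubword, w]
    rcases le_total j' j with hle | hle
    · refine Or.inr ⟨(l.drop i).take (i' - i), (l'.take (j + 1)).drop (j' + 1), ?_⟩
      conv_rhs => rw [hdrop, htake _ _ hle]
      simp only [List.append_assoc]
    · rcases hle.eq_or_lt with rfl | hlt
      · exact Or.inr ⟨(l.drop i).take (i' - i), [], by
          rw [List.append_nil, ← List.append_assoc, ← hdrop]⟩
      · obtain rfl : i = i' := by omega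
        refine Or.inl ⟨[], (l'.take (j' + 1)).drop (j + 1), ?_⟩
        rw [List.nil_append, List.append_assoc, ← htake _ _ hle]

theorem abs_le_supNorm {X : Type*} {f : X → ℝ} (hf : IsBddFun f) (x : X) : |f x| ≤ supNorm f := by
  obtain ⟨K, hK⟩ := hf
  exact le_ciSup (f := fun x => |f x|) ⟨K, by rintro _ ⟨p, rfl⟩; exact hK p⟩ x

theorem supNorm_nonneg {X : Type*} (f : X → ℝ) : 0 ≤ supNorm f :=
  Real.iSup_nonneg fun _ => abs_nonneg _

theorem abs_crossingSum_le_of_isIndependent {S : Type*} [DecidableEq S] {I : Set (FreeGroup S)}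
    (hI : IsIndependent I) {β : FreeGroup S → ℝ} (hb : IsBddFun β)
    (hβ : Function.support β ⊆ I) {l l' : List (S × Bool)} (hl : IsReduced (l ++ l'))
    {f : FreeGroup S → ℝ} {M : ℝ} (hf : ∀ x, |f x| ≤ M) :
    |crossingSum β l l' f| ≤ supNorm β * M := by
  have hM : 0 ≤ M := (abs_nonneg _).trans (hf 1)
  by_cases h : ∃ p ∈ Finset.range l.length ×ˢ Finset.range l'.length,
      β (mk (l.drop p.1 ++ l'.take (p.2 + 1))) ≠ 0
  · obtain ⟨p, hp, hpβ⟩ := h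
    rw [crossingSum, Finset.sum_eq_single_of_mem p hp]
    · rw [abs_mul]
      exact mul_le_mul (abs_le_supNorm hb _) (hf _) (abs_nonneg _) (supNorm_nonneg _)
    · intro q hq hqp
      by_contra hc
      have hqβ := left_ne_zero_of_mul hc
      simp only [Finset.mem_product, Finset.mem_range] at hp hq
      refine hqp (Prod.ext_iff.2 ?_)
      rcases le_total q.1 p.1 with hle | hle
      · exact crossing_unique hI hl hp.1 hq.2 hp.2 (hβ hqβ) (hβ hpβ) hle
      · have := crossing_unique hI hl hq.1 hp.2 hq.2 (hβ hpβ) (hβ hqβ) hle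
        exact ⟨this.1.symm, this.2.symm⟩
  · push Not at h
    rw [crossingSum, Finset.sum_eq_zero fun p hp => by rw [h p hp, zero_mul], abs_zero]
    exact mul_nonneg (supNorm_nonneg _) hM

/-- The crossing sum is finite, so pointwise convergence of `∑ β k` is enough to sum the bounds for
the single `β k`. -/
theorem abs_crossingSum_le_of_isIndSum {S : Type*} [DecidableEq S] {α : FreeGroup S → ℝ}
    {β : ℕ → FreeGroup S → ℝ} (hβ : IsIndSum α β) {l l' : List (S × Bool)}
    (hl : IsReduced (l ++ l')) {f : FreeGroup S → ℝ} {M : ℝ} (hf : ∀ x, |f x| ≤ M) :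
    |crossingSum α l l' f| ≤ (∑' k, supNorm (β k)) * M := by
  have h1 : HasSum (fun k => crossingSum (β k) l l' f) (crossingSum α l l' f) :=
    hasSum_sum fun p _ => (hβ.hasSum _).mul_right _
  have h2 : HasSum (fun k => supNorm (β k) * M) ((∑' k, supNorm (β k)) * M) :=
    hβ.summable.hasSum.mul_right M
  have h3 : ∀ k, |crossingSum (β k) l l' f| ≤ supNorm (β k) * M := by
    intro k
    obtain ⟨I, -, hI, hsupp⟩ := hβ.supported k
    exact abs_crossingSum_le_of_isIndependent hI (hβ.bdd k) hsupp hl hf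
  rw [← h1.tsum_eq]
  exact tsum_of_norm_bounded (f := fun k => crossingSum (β k) l l' f) h2 h3

theorem abs_crossingSum_le_SInd {S : Type*} [DecidableEq S] {α : FreeGroup S → ℝ}
    (hα : MemEllOneInd α) {l l' : List (S × Bool)}
    (hl : IsReduced (l ++ l')) {f : FreeGroup S → ℝ} {M : ℝ} (hf : ∀ x, |f x| ≤ M) :
    |crossingSum α l l' f| ≤ SInd α * M := by
  obtain ⟨β₀, hβ₀⟩ := hα.exists_indSum
  -- For `M > 0`, division by `M` yields a lower bound for all presentations, hence for their
  -- infimum; `M = 0` needs just one.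
  rcases ((abs_nonneg _).trans (hf 1)).eq_or_lt with rfl | hM
  · simpa using abs_crossingSum_le_of_isIndSum hβ₀ hl hf
  · rw [← div_le_iff₀ hM]
    refine le_csInf ⟨_, β₀, hβ₀, rfl⟩ ?_
    rintro s ⟨β, hβ, rfl⟩
    rw [div_le_iff₀ hM]
    exact abs_crossingSum_le_of_isIndSum hβ hl hf

theorem SInd_nonneg {S : Type*} [DecidableEq S] (α : FreeGroup S → ℝ) : 0 ≤ SInd α := by
  refine Real.sInf_nonneg ?_
  rintro s ⟨β, -, rfl⟩
  exact tsum_nonneg fun k => supNorm_nonneg _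

/-- A crossing word of length at most `N` starts in the last `N` letters of `l` and ends in the
first `N` of `l'`. This crude count is only meant to show that `H_w` is a quasimorphism. -/
theorem abs_crossingSum_le_of_norm_le {S : Type*} [DecidableEq S] {α : FreeGroup S → ℝ} {B : ℝ}
    {N : ℕ} (hB : ∀ v, |α v| ≤ B) (hN : ∀ v, α v ≠ 0 → v.norm ≤ N) {l l' : List (S × Bool)}
    (hl : IsReduced (l ++ l')) {f : FreeGroup S → ℝ} {M : ℝ} (hf : ∀ x, |f x| ≤ M) :
    |crossingSum α l l' f| ≤ (N * N * B) * M := by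
  have hM : 0 ≤ M := (abs_nonneg _).trans (hf 1)
  have hB0 : 0 ≤ B := (abs_nonneg _).trans (hB 1)
  let T := Finset.Ico (l.length - N) l.length ×ˢ Finset.range N
  have hcard : T.card ≤ N * N := by
    rw [Finset.card_product, Nat.card_Ico, Finset.card_range]
    exact Nat.mul_le_mul_right _ (by omega)
  have hsum : |crossingSum α l l' f| ≤
      ∑ p ∈ Finset.range l.length ×ˢ Finset.range l'.length, if p ∈ T then B * M else 0 := by
    refine (Finset.abs_sum_le_sum_abs _ _).trans (Finset.sum_le_sum fun p hp => ?_)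
    rw [abs_mul]
    split_ifs with hpT
    · exact mul_le_mul (hB _) (hf _) (abs_nonneg _) hB0
    · suffices α (mk (l.drop p.1 ++ l'.take (p.2 + 1))) = 0 by simp [this]
      by_contra hc
      have hlen := hN _ hc
      rw [FreeGroup.norm, toWord_mk_of_isReduced (isReduced_of_infix hl (crossing_infix l l' _ _)),
        List.length_append, List.length_drop, List.length_take] at hlen
      simp only [T, Finset.mem_product, Finset.mem_range, Finset.mem_Ico] at hp hpT
      omega
  refine hsum.trans ?_
  rw [← Finset.sum_filter, Finset.sum_const, nsmul_eq_mul, mul_assoc]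
  refine mul_le_mul_of_nonneg_right ?_ (mul_nonneg hB0 hM)
  exact_mod_cast (Finset.card_le_card fun p hp => (Finset.mem_filter.1 hp).2).trans hcard

/-! ### Counting functions as sums over subwords -/

theorem mem_occurrences {S : Type*} [DecidableEq S] {w g : FreeGroup S} {i : ℕ} :
    i ∈ occurrences w g ↔ ∃ u z, u.length = i ∧ g.toWord = u ++ w.toWord ++ z := by
  simp only [occurrences, Finset.mem_filter, Finset.mem_range]
  constructor
  · rintro ⟨hi, z, hz⟩
    refine ⟨g.toWord.take i, z, ?_, ?_⟩
    · rw [List.length_take]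
      exact min_eq_left (Nat.lt_succ_iff.1 hi)
    · rw [List.append_assoc, hz, List.take_append_drop]
  · rintro ⟨u, z, rfl, h⟩
    refine ⟨?_, ?_⟩
    · rw [FreeGroup.norm, h]
      simp
    · rw [h, List.append_assoc, List.drop_left]
      exact List.prefix_append _ _

/-- Inversion reverses positions. The subtraction does not truncate, since an occurrence at `i` has
`i + |w| ≤ |g|`. -/
theorem bigCount_inv_le {S : Type*} [DecidableEq S] (w g : FreeGroup S) :
    bigCount w g ≤ bigCount w⁻¹ g⁻¹ := by
  refine Finset.card_le_card_of_injOn (fun i => g.norm - w.norm - i) ?_ ?_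
  · intro i hi
    obtain ⟨u, z, rfl, h⟩ := mem_occurrences.1 hi
    refine mem_occurrences.2 ⟨invRev z, invRev u, ?_, ?_⟩
    · simp [FreeGroup.norm, h]
      omega
    · simp [toWord_inv, h]
  · intro i hi j hj hij
    obtain ⟨u, z, rfl, h⟩ := mem_occurrences.1 hi
    obtain ⟨u', z', rfl, h'⟩ := mem_occurrences.1 hj
    have e := congrArg List.length h
    have e' := congrArg List.length h'
    simp only [FreeGroup.norm, List.length_append] at hij e e'
    omega

theorem bigCount_inv {S : Type*} [DecidableEq S] (w g : FreeGroup S) :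
    bigCount w g⁻¹ = bigCount w⁻¹ g := by
  refine le_antisymm ?_ ?_
  · simpa using bigCount_inv_le w g⁻¹
  · simpa using bigCount_inv_le w⁻¹ g

theorem bigBrooks_inv {S : Type*} [DecidableEq S] (w : FreeGroup S) :
    IsAlternating (bigBrooks w) := by
  intro g
  simp only [bigBrooks, bigCount_inv, inv_inv]
  ring

/-- Two distinct occurrences that are not disjoint would make `w` overlap itself, so the set of all
occurrences is already disjoint. -/
theorem smallCount_eq_bigCount {S : Type*} [DecidableEq S] {w : FreeGroup S}
    (hw : w ∈ nonSelfOverlapping S) (g : FreeGroup S) : smallCount w g = bigCount w g := by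
  refine le_antisymm (Finset.sup_le fun t ht => ?_) ?_
  · exact Finset.card_le_card (Finset.mem_powerset.1 (Finset.mem_filter.1 ht).1)
  · refine Finset.le_sup (f := Finset.card) (Finset.mem_filter.2
      ⟨Finset.mem_powerset_self _, fun i hi j hj hij => ?_⟩)
    by_contra hc
    refine hw (Or.inr (Or.inl ?_))
    obtain ⟨u, z, rfl, h⟩ := mem_occurrences.1 hi
    obtain ⟨u', z', rfl, h'⟩ := mem_occurrences.1 hj
    rw [FreeGroup.norm] at hc
    set k := u'.length - u.length with hk
    have key : w.toWord.drop k ++ z = w.toWord ++ z' := by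
      have e1 : g.toWord.drop u'.length = w.toWord ++ z' := by
        rw [h', List.append_assoc, List.drop_left]
      rw [← e1, h, List.append_assoc, show u'.length = u.length + k by omega,
        List.drop_length_add_append, List.drop_append_of_le_length (by omega)]
    obtain ⟨r, hr, -⟩ | ⟨r, hr, -⟩ := List.append_eq_append_iff.1 key
    · refine ⟨w.toWord.take k, w.toWord.drop k, r, ?_, ?_, ?_, ?_, hr⟩
      · refine List.ne_nil_of_length_pos ?_
        rw [List.length_take]
        omega
      · refine List.ne_nil_of_length_pos ?_
        rw [List.length_drop]
        omega
      · rintro rfl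
        have := congrArg List.length hr
        rw [List.append_nil, List.length_drop] at this
        omega
      · rw [List.take_append_drop]
    · have := congrArg List.length hr
      rw [List.length_append, List.length_drop] at this
      omega

theorem bigCount_eq_sum {S : Type*} [DecidableEq S] {w : FreeGroup S} (hw : w ≠ 1)
    (g : FreeGroup S) : (bigCount w g : ℝ) = ∑ i ∈ Finset.range g.toWord.length,
      ∑ j ∈ Finset.range (g.toWord.drop i).length,
        if mk ((g.toWord.drop i).take (j + 1)) = w then (1 : ℝ) else 0 := by
  have hw' : w.toWord ≠ [] := by simpa using hw
  -- The end position `g.norm` can only carry the empty word.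
  rw [bigCount, occurrences, Finset.card_filter, FreeGroup.norm, Finset.sum_range_succ,
    List.drop_length, if_neg (by simpa using hw'), add_zero]
  push_cast
  refine Finset.sum_congr rfl fun i _ => ?_
  set l := g.toWord.drop i with hl
  have hred : ∀ j, (mk (l.take j)).toWord = l.take j := fun j =>
    toWord_mk_of_isReduced (isReduced_of_infix isReduced_toWord
      ((List.take_prefix _ _).isInfix.trans (List.drop_suffix _ _).isInfix))
  split_ifs with h
  · have hpos := List.length_pos_of_ne_nil hw'
    have hle := h.length_le
    rw [Finset.sum_eq_single_of_mem (w.toWord.length - 1) (by simp only [Finset.mem_range]; omega),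
      if_pos]
    · rw [Nat.sub_add_cancel hpos, ← List.prefix_iff_eq_take.1 h, mk_toWord]
    · intro j hj hne
      refine if_neg fun hc => hne ?_
      have := congrArg (fun x => x.toWord.length) hc
      simp only [hred, List.length_take] at this
      simp only [Finset.mem_range] at hj
      omega
  · refine (Finset.sum_eq_zero fun j _ => if_neg fun hc => h ?_).symm
    rw [← hc, hred]
    exact List.take_prefix _ _

theorem mk_take_drop_ne_one {S : Type*} [DecidableEq S] (g : FreeGroup S) {i j : ℕ}
    (hj : j < (g.toWord.drop i).length) : mk ((g.toWord.drop i).take (j + 1)) ≠ 1 := by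
  intro hc
  have := congrArg (fun x => x.toWord.length) hc
  simp only [toWord_mk_of_isReduced (isReduced_of_infix isReduced_toWord
    ((List.take_prefix _ _).isInfix.trans (List.drop_suffix i g.toWord).isInfix)),
    List.length_take, toWord_one, List.length_nil] at this
  omega

theorem subwordFunctional_one {S : Type*} (α : FreeGroup S → ℝ) (l : List (S × Bool)) :
    subwordFunctional α l (fun _ => 1) = ∑ i ∈ Finset.range l.length,
      ∑ j ∈ Finset.range (l.drop i).length, α (mk ((l.drop i).take (j + 1))) := by
  simp [subwordFunctional_apply, prefixFunctional_apply]

theorem bigBrooks_eq_subwordFunctional {S : Type*} [DecidableEq S] {w : FreeGroup S} (hw : w ≠ 1)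
    (g : FreeGroup S) : bigBrooks w g = subwordFunctional
      (fun v => (if v = w then (1 : ℝ) else 0) - if v = w⁻¹ then 1 else 0) g.toWord
      fun _ => 1 := by
  rw [bigBrooks, bigCount_eq_sum hw, bigCount_eq_sum (inv_ne_one.2 hw), subwordFunctional_one]
  simp only [Finset.sum_sub_distrib]

theorem bigBrooks_one {S : Type*} [DecidableEq S] : bigBrooks (1 : FreeGroup S) = 0 := by
  funext g
  simp [bigBrooks]

theorem isQuasimorphism_bigBrooks {S : Type*} [DecidableEq S] (w : FreeGroup S) :
    IsQuasimorphism (bigBrooks w) := by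
  rcases eq_or_ne w 1 with rfl | hw
  · exact ⟨0, fun p => by simp [bigBrooks_one]⟩
  · have h := isReducedLift_subwordFunctional (S := S) (K := w.norm * w.norm * 1)
      (α := fun v => (if v = w then (1 : ℝ) else 0) - if v = w⁻¹ then 1 else 0)
      fun l l' f M hl hf => abs_crossingSum_le_of_norm_le
        (fun v => by split_ifs <;> simp) (fun v hv => ?_) hl hf
    · simp only [← bigBrooks_eq_subwordFunctional hw] at h
      exact (h.isQuasiLift (bigBrooks_inv w)).isQuasimorphism
    · by_contra hlt
      refine hv ?_
      have h1 : v ≠ w := by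
        rintro rfl
        exact hlt le_rfl
      have h2 : v ≠ w⁻¹ := by
        rintro rfl
        exact hlt norm_inv_eq.le
      simp [h1, h2]

/-- The non-trivial subwords of `g`. -/
def subwords {S : Type*} [DecidableEq S] (g : FreeGroup S) : Finset (FreeGroup S) :=
  (Finset.range g.toWord.length).biUnion fun i =>
    (Finset.range (g.toWord.drop i).length).image fun j => mk ((g.toWord.drop i).take (j + 1))

theorem mem_subwords_of_mk {S : Type*} [DecidableEq S] {g : FreeGroup S} {i j : ℕ}
    (hi : i ∈ Finset.range g.toWord.length) (hj : j ∈ Finset.range (g.toWord.drop i).length) :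
    mk ((g.toWord.drop i).take (j + 1)) ∈ subwords g :=
  Finset.mem_biUnion.2 ⟨i, hi, Finset.mem_image_of_mem _ hj⟩

theorem one_notMem_subwords {S : Type*} [DecidableEq S] (g : FreeGroup S) :
    (1 : FreeGroup S) ∉ subwords g := by
  simp only [subwords, Finset.mem_biUnion, Finset.mem_image, not_exists, not_and]
  exact fun i _ j hj => mk_take_drop_ne_one g (Finset.mem_range.1 hj)

theorem bigCount_eq_zero {S : Type*} [DecidableEq S] {w g : FreeGroup S} (hw : w ≠ 1)
    (h : w ∉ subwords g) : (bigCount w g : ℝ) = 0 := by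
  rw [bigCount_eq_sum hw]
  refine Finset.sum_eq_zero fun i hi => Finset.sum_eq_zero fun j hj => if_neg ?_
  rintro rfl
  exact h (mem_subwords_of_mk hi hj)

/-- Groups the subwords by value. The freedom in `W` allows a set closed under inversion in
`MemEllOneInd.brooksSum_eq`. -/
theorem subwordFunctional_eq_sum_bigCount {S : Type*} [DecidableEq S] (α : FreeGroup S → ℝ)
    {g : FreeGroup S} {W : Finset (FreeGroup S)} (hW : subwords g ⊆ W) (h1 : 1 ∉ W) :
    subwordFunctional α g.toWord (fun _ => 1) = ∑ w ∈ W, α w * bigCount w g := by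
  rw [Finset.sum_congr rfl fun w hw => by
    rw [bigCount_eq_sum (ne_of_mem_of_not_mem hw h1), Finset.mul_sum], Finset.sum_comm,
    subwordFunctional_one]
  refine Finset.sum_congr rfl fun i hi => ?_
  simp only [Finset.mul_sum]
  rw [Finset.sum_comm]
  refine Finset.sum_congr rfl fun j hj => ?_
  simp only [mul_ite, mul_one, mul_zero]
  rw [Finset.sum_ite_eq, if_pos (hW (mem_subwords_of_mk hi hj))]

theorem MemEllOneInd.mul_smallBrooks {S : Type*} [DecidableEq S] {α : FreeGroup S → ℝ}
    (hα : MemEllOneInd α) (w g : FreeGroup S) :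
    α w * smallBrooks w g = α w * bigBrooks w g := by
  by_cases h : α w = 0
  · rw [h, zero_mul, zero_mul]
  · have h' : α w⁻¹ ≠ 0 := by
      rw [hα.alternating]
      exact neg_ne_zero.2 h
    rw [smallBrooks, smallCount_eq_bigCount (hα.supported h),
      smallCount_eq_bigCount (hα.supported h'), bigBrooks]

theorem MemEllOneInd.isAlternating_brooksSum {S : Type*} [DecidableEq S] {α : FreeGroup S → ℝ}
    (hα : MemEllOneInd α) (P : Set (FreeGroup S)) : IsAlternating (brooksSum P α) := by
  intro g
  simp only [brooksSum, hα.mul_smallBrooks, bigBrooks_inv _ g, mul_neg, finsum_neg_distrib]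

theorem MemEllOneInd.brooksSum_eq {S : Type*} [DecidableEq S] {α : FreeGroup S → ℝ}
    (hα : MemEllOneInd α) {P : Set (FreeGroup S)} (hP : IsPositiveHalf (nonSelfOverlapping S) P)
    (g : FreeGroup S) : brooksSum P α g = subwordFunctional α g.toWord fun _ => 1 := by
  classical
  have hα1 : α 1 = 0 := by
    have := hα.alternating 1
    rw [inv_one] at this
    linarith
  set W : Finset (FreeGroup S) := subwords g ∪ (subwords g).image (·⁻¹) with hW
  have hWinv : ∀ w, w⁻¹ ∈ W ↔ w ∈ W := by
    intro w
    simp only [hW, Finset.mem_union, Finset.mem_image, inv_eq_iff_eq_inv, exists_eq_right, inv_inv]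
    exact or_comm
  have hW1 : (1 : FreeGroup S) ∉ W := by
    simp [hW, one_notMem_subwords]
  have hsupp : Function.support (P.indicator fun w => α w * smallBrooks w g) ⊆ W := by
    intro w hw
    by_contra hwW
    refine hw ?_
    have hw1 : w ≠ 1 := by
      rintro rfl
      exact hw (by simp [Set.indicator_apply, hα1])
    have e1 := bigCount_eq_zero hw1 fun h => hwW (Finset.mem_union_left _ h)
    have e2 := bigCount_eq_zero (inv_ne_one.2 hw1)
      fun h => hwW ((hWinv w).1 (Finset.mem_union_left _ h))
    rw [Set.indicator_apply, hα.mul_smallBrooks, bigBrooks, e1, e2]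
    simp
  rw [brooksSum, finsum_mem_def, finsum_eq_sum_of_support_subset _ hsupp,
    subwordFunctional_eq_sum_bigCount α (W := W) Finset.subset_union_left hW1]
  have hsplit : ∀ w, P.indicator (fun w => α w * smallBrooks w g) w =
      (if w ∈ P then α w * bigCount w g else 0) +
        if w ∈ P then α w⁻¹ * bigCount w⁻¹ g else 0 := by
    intro w
    rw [Set.indicator_apply, hα.mul_smallBrooks, bigBrooks, hα.alternating]
    split_ifs <;> ring
  -- Substituting `w⁻¹` for `w` in the second half leaves `α w * bigCount w g` once for `w ∈ P` and
  -- once for `w⁻¹ ∈ P`; exactly one of these holds where `α w ≠ 0`.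
  rw [Finset.sum_congr rfl fun w _ => hsplit w, Finset.sum_add_distrib,
    Finset.sum_nbij' (s := W) (t := W) (f := fun w => if w ∈ P then α w⁻¹ * bigCount w⁻¹ g else 0)
      (g := fun w => if w⁻¹ ∈ P then α w * bigCount w g else 0) (·⁻¹) (·⁻¹)
      (fun w hw => (hWinv w).2 hw) (fun w hw => (hWinv w).2 hw) (fun w _ => inv_inv w)
      (fun w _ => inv_inv w) (fun w _ => by simp only [inv_inv]), ← Finset.sum_add_distrib]
  refine Finset.sum_congr rfl fun w hw => ?_
  by_cases h : α w = 0
  · simp [h]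
  · rcases hP.2 w (hα.supported h) (ne_of_mem_of_not_mem hw hW1) with ⟨h1, h2⟩ | ⟨h1, h2⟩ <;>
      simp [h1, h2]

theorem MemEllOneInd.isQuasiLift {S : Type*} [DecidableEq S] {α : FreeGroup S → ℝ}
    (hα : MemEllOneInd α) {P : Set (FreeGroup S)}
    (hP : IsPositiveHalf (nonSelfOverlapping S) P) :
    IsQuasiLift (brooksSum P α) (antisymmetrize fun g => subwordFunctional α g.toWord)
      (3 * SInd α) := by
  have h := isReducedLift_subwordFunctional (α := α) (K := SInd α)
    fun l l' f M hl hf => abs_crossingSum_le_SInd hα hl hf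
  simp only [← hα.brooksSum_eq hP] at h
  exact h.isQuasiLift (hα.isAlternating_brooksSum P)

/-! ### Rolli quasimorphisms -/

/-- Puts a power of a generator in front of a list of powers, merging it with the first one if
the generators agree. -/
def consPower {S : Type*} [DecidableEq S] (p : S × ℤ) : List (S × ℤ) → List (S × ℤ)
  | [] => [p]
  | q :: r => if p.1 = q.1 then (q.1, p.2 + q.2) :: r else p :: q :: r

/-- The exponent of a letter. -/
def letterPower {S : Type*} (x : S × Bool) : S × ℤ := (x.1, if x.2 then 1 else -1)

theorem syllables_cons {S : Type*} [DecidableEq S] (x : S × Bool) (l : List (S × Bool)) :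
    syllables (x :: l) = consPower (letterPower x) (syllables l) := by
  obtain ⟨s, b⟩ := x
  rw [syllables]
  split <;> rename_i h <;> rw [h] <;> rfl

theorem consPower_append {S : Type*} [DecidableEq S] (p : S × ℤ) {l : List (S × ℤ)} (hl : l ≠ [])
    (l' : List (S × ℤ)) : consPower p (l ++ l') = consPower p l ++ l' := by
  cases l with
  | nil => exact absurd rfl hl
  | cons q r =>
    simp only [List.cons_append, consPower]
    split_ifs <;> rfl

/-- Adding a power in front commutes with adding one at the end, so a recursion from the front also
describes appending a letter. -/
theorem consPower_reverse_consPower {S : Type*} [DecidableEq S] (p q : S × ℤ)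
    (l : List (S × ℤ)) : consPower p (consPower q l.reverse).reverse =
      (consPower q (consPower p l).reverse).reverse := by
  rcases l with _ | ⟨a, l⟩
  · by_cases h : p.1 = q.1
    · simp [consPower, h, add_comm]
    · simp [consPower, h, Ne.symm h]
  rcases List.eq_nil_or_concat l with rfl | ⟨m, b, rfl⟩
  · by_cases h : p.1 = a.1 <;> by_cases h' : q.1 = a.1 <;>
      simp [consPower, h, h', add_left_comm]
  · by_cases h : p.1 = a.1 <;> by_cases h' : q.1 = b.1 <;>
      simp [consPower, h, h']

theorem syllables_concat {S : Type*} [DecidableEq S] (l : List (S × Bool)) (x : S × Bool) :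
    syllables (l ++ [x]) = (consPower (letterPower x) (syllables l).reverse).reverse := by
  induction l with
  | nil => simp [syllables_cons, syllables, consPower]
  | cons y l ih =>
    rw [List.cons_append, syllables_cons, ih, syllables_cons, consPower_reverse_consPower]

theorem map_neg_consPower {S : Type*} [DecidableEq S] (p : S × ℤ) (l : List (S × ℤ)) :
    (consPower p l).map (fun q => (q.1, -q.2)) =
      consPower (p.1, -p.2) (l.map fun q => (q.1, -q.2)) := by
  cases l with
  | nil => rfl
  | cons q r =>
    simp only [consPower, List.map_cons]
    split_ifs
    · simp [add_comm]
    · rfl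

theorem syllables_invRev {S : Type*} [DecidableEq S] (l : List (S × Bool)) :
    syllables (invRev l) = ((syllables l).map fun q => (q.1, -q.2)).reverse := by
  induction l with
  | nil => rfl
  | cons x l ih =>
    have hx : letterPower (x.1, !x.2) = ((letterPower x).1, -(letterPower x).2) := by
      rcases x with ⟨s, _ | _⟩ <;> rfl
    have hl : invRev (x :: l) = invRev l ++ [(x.1, !x.2)] := by simp [invRev]
    rw [hl, syllables_concat, ih, List.reverse_reverse, syllables_cons, map_neg_consPower, hx]

theorem isAlternating_rolli {S : Type*} [DecidableEq S] {lam : S → ℤ → ℝ}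
    (h : IsRolliParam lam) : IsAlternating (rolli lam) := by
  intro g
  rw [rolli, rolli, toWord_inv, syllables_invRev, List.map_reverse, List.sum_reverse]
  induction syllables g.toWord with
  | nil => simp
  | cons p l ih =>
    simp only [List.map_cons, List.sum_cons, ih, (h p.1).2]
    ring

/-- Concatenating words concatenates their syllables, except that the two powers that meet may
merge. -/
theorem syllables_append {S : Type*} [DecidableEq S] (l l' : List (S × Bool)) :
    syllables (l ++ l') = syllables l ++ syllables l' ∨
      ∃ A s m n C, syllables l = A ++ [(s, m)] ∧ syllables l' = (s, n) :: C ∧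
        syllables (l ++ l') = A ++ (s, m + n) :: C := by
  induction l with
  | nil => exact Or.inl rfl
  | cons x l ih =>
    rw [List.cons_append, syllables_cons, syllables_cons]
    -- If `l` has no syllables, the new letter meets `l'` directly; otherwise it only alters the
    -- first syllable of `l`.
    by_cases hl : syllables l = []
    · have hl' : syllables (l ++ l') = syllables l' := by
        rcases ih with h | ⟨A, s, m, n, C, h, -⟩
        · rw [h, hl, List.nil_append]
        · simp [hl] at h
      rw [hl', hl]
      rcases hs : syllables l' with _ | ⟨q, r⟩
      · exact Or.inl rfl
      · simp only [consPower]
        split_ifs with h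
        · refine Or.inr ⟨[], q.1, (letterPower x).2, q.2, r, ?_, rfl, rfl⟩
          rw [← h]
          rfl
        · exact Or.inl rfl
    · rcases ih with h | ⟨A, s, m, n, C, h, hC, h'⟩
      · left
        rw [h, consPower_append _ hl]
      · right
        rw [h, h']
        -- For `A = []` the new letter may merge into the very power that meets `l'`.
        rcases A with _ | ⟨a, A⟩
        · simp only [List.nil_append, consPower]
          split_ifs
          · exact ⟨[], s, _, n, C, rfl, hC, by simp [add_assoc]⟩
          · exact ⟨[letterPower x], s, m, n, C, rfl, hC, rfl⟩
        · refine ⟨consPower (letterPower x) (a :: A), s, m, n, C, ?_, hC, ?_⟩ <;>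
            rw [consPower_append _ (List.cons_ne_nil _ _)]

/-- The product of a list of powers of generators. -/
def powerProd {S : Type*} (l : List (S × ℤ)) : FreeGroup S :=
  (l.map fun p => of p.1 ^ p.2).prod

theorem powerProd_consPower {S : Type*} [DecidableEq S] (p : S × ℤ) (l : List (S × ℤ)) :
    powerProd (consPower p l) = of p.1 ^ p.2 * powerProd l := by
  cases l with
  | nil => rfl
  | cons q r =>
    simp only [consPower]
    split_ifs with h
    · simp [powerProd, h, zpow_add, mul_assoc]
    · simp [powerProd]

theorem powerProd_syllables {S : Type*} [DecidableEq S] (l : List (S × Bool)) :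
    powerProd (syllables l) = mk l := by
  induction l with
  | nil => rfl
  | cons x l ih =>
    rw [syllables_cons, powerProd_consPower, ih, ← List.singleton_append, ← mul_mk]
    congr 1
    rcases x with ⟨s, _ | _⟩
    · simp only [letterPower, Bool.false_eq_true, if_false, zpow_neg, zpow_one]
      rfl
    · simp only [letterPower, if_true, zpow_one]
      rfl

/-- The functional `f ↦ ∑ λ(v) f(z)` over the factorizations `l = u v z` with a single power `v`. -/
noncomputable def powerFunctional {S : Type*} (lam : S → ℤ → ℝ) :
    List (S × ℤ) → (FreeGroup S → ℝ) →ₗ[ℝ] ℝ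
  | [] => 0
  | p :: l => lam p.1 p.2 • LinearMap.proj (powerProd l) + powerFunctional lam l

theorem powerFunctional_cons {S : Type*} (lam : S → ℤ → ℝ) (p : S × ℤ) (l : List (S × ℤ))
    (f : FreeGroup S → ℝ) : powerFunctional lam (p :: l) f =
      lam p.1 p.2 * f (powerProd l) + powerFunctional lam l f := rfl

theorem powerFunctional_nil {S : Type*} (lam : S → ℤ → ℝ) (f : FreeGroup S → ℝ) :
    powerFunctional lam [] f = 0 := rfl

theorem powerProd_append {S : Type*} (l l' : List (S × ℤ)) :
    powerProd (l ++ l') = powerProd l * powerProd l' := by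
  simp [powerProd]

theorem powerFunctional_append {S : Type*} (lam : S → ℤ → ℝ) (l l' : List (S × ℤ))
    (f : FreeGroup S → ℝ) : powerFunctional lam (l ++ l') f =
      powerFunctional lam l (fun x => f (x * powerProd l')) + powerFunctional lam l' f := by
  induction l with
  | nil => simp [powerFunctional_nil]
  | cons p l ih =>
    rw [List.cons_append, powerFunctional_cons, powerFunctional_cons, ih, powerProd_append]
    ring

theorem powerFunctional_one {S : Type*} (lam : S → ℤ → ℝ) (l : List (S × ℤ)) :
    powerFunctional lam l (fun _ => 1) = (l.map fun p => lam p.1 p.2).sum := by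
  induction l with
  | nil => rfl
  | cons p l ih => rw [powerFunctional_cons, ih, mul_one, List.map_cons, List.sum_cons]

theorem isReducedLift_rolli {S : Type*} [DecidableEq S] {lam : S → ℤ → ℝ} {B : ℝ}
    (hB0 : 0 ≤ B) (hB : ∀ s m, |lam s m| ≤ B) :
    IsReducedLift (rolli lam) (fun g => powerFunctional lam (syllables g.toWord)) (3 * B) where
  mass g := powerFunctional_one lam _
  bound a c f M hac hf := by
    have hM : 0 ≤ M := (abs_nonneg _).trans (hf 1)
    have hbd : ∀ s m x, |lam s m * f x| ≤ B * M := fun s m x => by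
      rw [abs_mul]
      exact mul_le_mul (hB _ _) (hf _) (abs_nonneg _) ((abs_nonneg _).trans (hB s m))
    have hc : powerProd (syllables c.toWord) = c := by rw [powerProd_syllables, mk_toWord]
    rw [hac]
    rcases syllables_append a.toWord c.toWord with h | ⟨A, s, m, n, C, hA, hC, h⟩
    · rw [h, powerFunctional_append, hc, add_sub_cancel_left, sub_self, abs_zero]
      positivity
    · rw [hC] at hc
      rw [h, hA, hC, powerFunctional_append, powerFunctional_append]
      -- The powers in `A` see the same remainder on both sides and cancel. Only the terms with
      -- exponents `m + n`, `m` and `n` survive.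
      have e1 : ∀ x, x * powerProd [(s, m)] * c = x * powerProd ((s, m + n) :: C) := by
        intro x
        rw [← hc]
        simp [powerProd, zpow_add, mul_assoc]
      simp only [powerFunctional_cons, powerFunctional_nil, e1, add_zero]
      have h1 := abs_le.1 (hbd s (m + n) (powerProd C))
      have h2 := abs_le.1 (hbd s m (powerProd [] * c))
      have h3 := abs_le.1 (hbd s n (powerProd C))
      rw [abs_le]
      constructor <;> linarith [h1.1, h1.2, h2.1, h2.2, h3.1, h3.2]

/-- Finiteness of `S` makes the separate bounds uniform, so that the supremum is a genuine one. -/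
theorem abs_le_rolliNorm {S : Type*} [Finite S] {lam : S → ℤ → ℝ} (h : IsRolliParam lam) (s : S)
    (m : ℤ) : |lam s m| ≤ rolliNorm lam := by
  cases nonempty_fintype S
  choose K hK using fun s => (h s).1
  refine abs_le_supNorm (f := fun p : S × ℤ => lam p.1 p.2) ⟨∑ t, |K t|, fun p => ?_⟩ (s, m)
  exact ((hK _ _).trans (le_abs_self _)).trans
    (Finset.single_le_sum (f := fun t => |K t|) (fun t _ => abs_nonneg _) (Finset.mem_univ p.1))

theorem IsRolliParam.isQuasiLift {S : Type*} [DecidableEq S] [Finite S] {lam : S → ℤ → ℝ}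
    (h : IsRolliParam lam) :
    IsQuasiLift (rolli lam)
      (antisymmetrize fun g => powerFunctional lam (syllables g.toWord))
      (3 * (3 * rolliNorm lam)) :=
  (isReducedLift_rolli (supNorm_nonneg _) (abs_le_rolliNorm h)).isQuasiLift (isAlternating_rolli h)

/-! ### The main theorem -/

/-- The factor `|w|` is slack: it is at least 1 unless `w = 1`, and then `H_w = 0`. -/
theorem defect_bigBrooks_le {S : Type*} [DecidableEq S] (w : FreeGroup S) :
    defect (bigBrooks w) ≤ defect (bigBrooks w) * w.norm := by
  rcases eq_or_ne w 1 with rfl | hw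
  · simp [bigBrooks_one, defect, supNorm]
  · refine le_mul_of_one_le_right (defect_nonneg _) ?_
    exact_mod_cast Nat.one_le_iff_ne_zero.2 (mt norm_eq_zero.1 hw)

theorem IsQuasiLift.cupVanishes_bigBrooks {S : Type*} [DecidableEq S] {φ : FreeGroup S → ℝ}
    {E : FreeGroup S → (FreeGroup S → ℝ) →ₗ[ℝ] ℝ} {K N : ℝ} (hE : IsQuasiLift φ E K)
    (hN : 0 ≤ N) (hK : K ≤ 9 * N) (w : FreeGroup S) :
    CupVanishes φ (bigBrooks w) (9 * (N * (defect (bigBrooks w) * (w.norm : ℝ)))) := by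
  refine hE.cupVanishes (isQuasimorphism_bigBrooks w) ?_
  rw [← mul_assoc]
  exact mul_le_mul hK (defect_bigBrooks_le w) (defect_nonneg _) (by positivity)

end FreeWord

theorem mainTheorem3 :
    ∃ C : ℝ, 0 < C ∧ ∀ n : ℕ, 2 ≤ n → ∀ w : FreeGroup (Fin n),
      (∀ P : Set (FreeGroup (Fin n)),
        FreeWord.IsPositiveHalf (FreeWord.nonSelfOverlapping (Fin n)) P →
        ∀ α : FreeGroup (Fin n) → ℝ, FreeWord.MemEllOneInd α →
          FreeWord.CupVanishes (FreeWord.brooksSum P α) (FreeWord.bigBrooks w)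
            (C * (FreeWord.SInd α * (defect (FreeWord.bigBrooks w) * (w.norm : ℝ))))) ∧
      (∀ lam : Fin n → ℤ → ℝ, FreeWord.IsRolliParam lam →
          FreeWord.CupVanishes (FreeWord.rolli lam) (FreeWord.bigBrooks w)
            (C * (FreeWord.rolliNorm lam * (defect (FreeWord.bigBrooks w) * (w.norm : ℝ))))) := by
  -- The Rolli case needs 3 · 3; for `ℓ¹_Ind` the lift has constant `3 * SInd α`.
  refine ⟨9, by norm_num, fun n _ w => ⟨fun P hP α hα => ?_, fun lam hlam => ?_⟩⟩
  · have h0 := FreeWord.SInd_nonneg α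
    exact (hα.isQuasiLift hP).cupVanishes_bigBrooks h0 (by linarith) w
  · have h0 : 0 ≤ FreeWord.rolliNorm lam := FreeWord.supNorm_nonneg _
    exact hlam.isQuasiLift.cupVanishes_bigBrooks h0 (by linarith) w
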